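/- Let $M$ be a smooth manifold of dimension $2n\ge 4$ and let $G=(g,b)$ be a generalized metric on $TM\oplus T^*M$, i.e. $g$ is a Riemannian metric and $b$ a $2$-form on $M$. Write $gX=g(X,\cdot)$, $bX=b(X,\cdot)$, $g^{-1}:T^*M\to TM$ for the inverse of $X\mapsto gX$, $V^{\pm}=\{X\pm gX+bX\}$, so that $TM\oplus T^*M=V^+\oplus V^-$, and $X^{\pm}=X\pm gX+bX$. Let $[\cdot,\cdot]_C$ be the Courant bracket, $[u,v]_C=\tfrac12([u,v]_D-[v,u]_D)$ with $[X+\xi,Y+\eta]_D=[X,Y]+\mathcal L_X\eta-\iota_Y d\xi$, and let $\nabla^+$ be the affine connection $$\nabla^+_XY=\pi\big(([X^-,Y^+]_C)_+\big),$$ where $(\cdot)_+$ is the projection onto $V^+$ along $V^-$ and $\pi:TM\oplus T^*M\to TM$ is the projection. Let $A$ be the endomorphism of $TM$ with $g(AX,Y)=b(X,Y)$, let $Q=-A^2$, and let $db(X,Y)$ denote the $1$-form $db(X,Y,\cdot)$. Suppose that $b$ is non-degenerate, that $\nabla^+b=0$, and that for all smooth vector fields $X,Y,Z$ $$b\big(g^{-1}(db(X,AY))-g^{-1}(db(AX,Y)),Z\big)+b\big(g^{-1}(db(AY,Z)),X\big)-b\big(g^{-1}(db(Y,Z)),AX\big)-b\big(g^{-1}(db(Z,AX)),Y\big)+b\big(g^{-1}(db(Z,X)),AY\big)=0.$$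 Then $(M,g,A,Q)$ is a weak nearly Kähler manifold: $\dim M=2n\ge4$, $A$ is a smooth, $g$-skew-symmetric, non-singular endomorphism of $TM$, $Q=-A^2$, and $(\nabla^{LC}_XA)X=0$ for every smooth vector field $X$, equivalently $(\nabla^{LC}_XF)(X,Y)=0$ for all smooth vector fields $X,Y$, where $\nabla^{LC}$ is the Levi-Civita connection of $g$ and $F(X,Y)=g(AX,Y)$. -/

import Mathlib

open Bundle Manifold VectorField
open scoped ContDiff Topology

namespace GenGeom

section Calculus

variable {E : Type*} [NormedAddCommGroup E] [NormedSpace ℝ E]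
  {M : Type*} [TopologicalSpace M] [ChartedSpace E M]

variable (E M) in
/-- (Not necessarily smooth) vector fields on a manifold `M` modelled on `E`. -/
abbrev VField : Type _ := Π x : M, TangentSpace 𝓘(ℝ, E) x

variable (E M) in
/-- (Not necessarily smooth) `1`-forms on `M`. -/
abbrev OneForm : Type _ := Π x : M, TangentSpace 𝓘(ℝ, E) x →L[ℝ] ℝ

variable (E M) in
/-- (Not necessarily smooth) fields of bilinear forms on the tangent spaces of `M`. -/
abbrev BilinField : Type _ :=
  Π x : M, TangentSpace 𝓘(ℝ, E) x →L[ℝ] TangentSpace 𝓘(ℝ, E) x →L[ℝ] ℝ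

variable (E M) in
/-- (Not necessarily smooth) fields of endomorphisms of the tangent spaces of `M`. -/
abbrev EndField : Type _ :=
  Π x : M, TangentSpace 𝓘(ℝ, E) x →L[ℝ] TangentSpace 𝓘(ℝ, E) x

/-- The vector field `A X`. -/
noncomputable def EndField.app (A : EndField E M) (X : VField E M) : VField E M := fun x => A x (X x)

/-- The derivative `X f` of a function `f` along a vector field `X`. -/
noncomputable def dir (X : VField E M) (f : M → ℝ) : M → ℝ := fun x => mvfderiv 𝓘(ℝ, E) f x (X x)

theorem dir_mul {X : VField E M} {f h : M → ℝ} {x : M} (hf : MDiffAt f x) (hh : MDiffAt h x) :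
   dir X (fun y => f y * h y) x = f x * dir X h x + h x * dir X f x := by
  simp [dir, mvfderiv_fun_mul hf hh]

theorem dir_add {X : VField E M} {f h : M → ℝ} {x : M} (hf : MDiffAt f x) (hh : MDiffAt h x) :
   dir X (fun y => f y + h y) x = dir X f x + dir X h x := by
  simp [dir, mvfderiv_fun_add hf hh]

section Smooth

variable [IsManifold 𝓘(ℝ, E) ∞ M]

/-- `X` is a smooth section of `TM`. -/
def SmoothVF (X : VField E M) : Prop :=
  ContMDiff 𝓘(ℝ, E) (𝓘(ℝ, E).prod 𝓘(ℝ, E)) ∞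
    (fun x => TotalSpace.mk' E (E := (TangentSpace 𝓘(ℝ, E) : M → Type _)) x (X x))

/-- `A` is a smooth section of `End(TM)`. -/
def SmoothEnd (A : EndField E M) : Prop :=
  ContMDiff 𝓘(ℝ, E) (𝓘(ℝ, E).prod 𝓘(ℝ, E →L[ℝ] E)) ∞
    (fun x => TotalSpace.mk' (E →L[ℝ] E)
      (E := fun x : M => TangentSpace 𝓘(ℝ, E) x →L[ℝ] TangentSpace 𝓘(ℝ, E) x) x (A x))

/-- `b` is a smooth section of the bundle of bilinear forms on `TM`. -/
def SmoothBilin (b : BilinField E M) : Prop :=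
  ContMDiff 𝓘(ℝ, E) (𝓘(ℝ, E).prod 𝓘(ℝ, E →L[ℝ] E →L[ℝ] ℝ)) ∞
    (fun x => TotalSpace.mk' (E →L[ℝ] E →L[ℝ] ℝ)
      (E := fun x : M => TangentSpace 𝓘(ℝ, E) x →L[ℝ] TangentSpace 𝓘(ℝ, E) x →L[ℝ] ℝ) x (b x))

theorem SmoothBilin.mdiff {b : BilinField E M} (hb : SmoothBilin b) {X Y : VField E M} {x : M}
    (hX : MDiffAt (T% X) x) (hY : MDiffAt (T% Y) x) : MDiffAt (fun y => b y (X y) (Y y)) x := by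
  have : MDifferentiableAt 𝓘(ℝ, E) (𝓘(ℝ, E).prod 𝓘(ℝ))
      (fun m ↦ TotalSpace.mk' ℝ (E := Bundle.Trivial M ℝ) m (b m (X m) (Y m))) x := by
    apply MDifferentiableAt.clm_bundle_apply₂ (F₁ := E) (F₂ := E)
    · exact (hb x).mdifferentiableAt (by simp)
    · exact hX
    · exact hY
  simp only [mdifferentiableAt_totalSpace] at this
  exact this.2

end Smooth

variable [FiniteDimensional ℝ E] [IsManifold 𝓘(ℝ, E) ∞ M]

open Classical in
/-- The covector at `x` determined by a functional `Φ` on vector fields which is tensorial at `x`,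
i.e. the covector sending `Z x` to `Φ Z` for each `Z` that is differentiable at `x`
(`0` if `Φ` is not tensorial). -/
noncomputable def covectorOf (Φ : VField E M → ℝ) (x : M) : TangentSpace 𝓘(ℝ, E) x →L[ℝ] ℝ :=
  if h : TensorialAt 𝓘(ℝ, E) E Φ x then TensorialAt.mkHom Φ x h else 0

theorem covectorOf_apply {Φ : VField E M → ℝ} {x : M} (h : TensorialAt 𝓘(ℝ, E) E Φ x)
    {Z : VField E M} (hZ : MDiffAt (T% Z) x) : covectorOf Φ x (Z x) = Φ Z := by
  rw [covectorOf, dif_pos h, TensorialAt.mkHom_apply h hZ]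

/-- The exterior derivative of a `1`-form, evaluated on two vector fields:
`dξ(Y, Z) = Y ξ(Z) - Z ξ(Y) - ξ([Y, Z])`. -/
noncomputable def dOne (ξ : OneForm E M) (Y Z : VField E M) : M → ℝ := fun x =>
  dir Y (fun y => ξ y (Z y)) x - dir Z (fun y => ξ y (Y y)) x
    - ξ x (mlieBracket 𝓘(ℝ, E) Y Z x)

/-- The `1`-form `ι_Y dξ`. -/
noncomputable def iotaD (Y : VField E M) (ξ : OneForm E M) : OneForm E M :=
  fun x => covectorOf (fun Z => dOne ξ Y Z x) x

/-- The Lie derivative of a `1`-form: `(L_X η)(Z) = X η(Z) - η([X, Z])`. -/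
noncomputable def lieD (X : VField E M) (η : OneForm E M) : OneForm E M :=
  fun x => covectorOf
    (fun Z => dir X (fun y => η y (Z y)) x - η x (mlieBracket 𝓘(ℝ, E) X Z x)) x

/-- The exterior derivative of a `2`-form, evaluated on three vector fields. -/
noncomputable def dTwo (b : BilinField E M) (X Y Z : VField E M) : M → ℝ := fun x =>
  dir X (fun y => b y (Y y) (Z y)) x + dir Y (fun y => b y (Z y) (X y)) x
    + dir Z (fun y => b y (X y) (Y y)) x
    - b x (mlieBracket 𝓘(ℝ, E) X Y x) (Z x) - b x (mlieBracket 𝓘(ℝ, E) Y Z x) (X x)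
    - b x (mlieBracket 𝓘(ℝ, E) Z X x) (Y x)

/-- The `1`-form `db(X, Y) = db(X, Y, ·)`. -/
noncomputable def dTwoForm (b : BilinField E M) (X Y : VField E M) : OneForm E M :=
  fun x => covectorOf (fun Z => dTwo b X Y Z x) x

/-- `ξ` is differentiable at `x`, tested on vector fields that are differentiable at `x`. -/
def OneForm.DiffAt (ξ : OneForm E M) (x : M) : Prop :=
  ∀ Z : VField E M, MDiffAt (T% Z) x → MDiffAt (fun y => ξ y (Z y)) x

-- The functionals to which `covectorOf` is applied above are tensorial for differentiable data.

theorem lieD_tensorial {X : VField E M} {η : OneForm E M} {x : M} (hη : η.DiffAt x) :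
    TensorialAt 𝓘(ℝ, E) E (fun Z => dir X (fun y => η y (Z y)) x - η x (mlieBracket 𝓘(ℝ, E) X Z x)) x where
  smul {f Z} hf hZ := by
    simp [dir_mul hf (hη Z hZ), mlieBracket_smul_right hf hZ]
    simp [dir]; ring
  add {Z W} hZ hW := by
    simp [dir_add (hη Z hZ) (hη W hW), mlieBracket_add_right hZ hW]
    ring

theorem dOne_tensorial {Y : VField E M} {η : OneForm E M} {x : M} (hη : η.DiffAt x) :
    TensorialAt 𝓘(ℝ, E) E (fun Z => dOne η Y Z x) x where
  smul {f Z} hf hZ := by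
    simp [dOne, dir_mul hf (hη Z hZ), mlieBracket_smul_right hf hZ]
    simp [dir]; ring
  add {Z W} hZ hW := by
    simp [dOne, dir_add (hη Z hZ) (hη W hW), mlieBracket_add_right hZ hW]
    simp [dir]; ring

theorem dTwo_tensorial {X Y : VField E M} {b : BilinField E M} (hb : SmoothBilin b)
   (hs : ∀ x v w, b x v w = - b x w v) {x : M}
   (hX : MDiffAt (T% X) x) (hY : MDiffAt (T% Y) x) :
    TensorialAt 𝓘(ℝ, E) E (fun Z => dTwo b X Y Z x) x where
  smul {f Z} hf hZ := by
    simp [dTwo, dir_mul hf (hb.mdiff hY hZ), dir_mul hf (hb.mdiff hZ hX), mlieBracket_smul_right hf hZ, mlieBracket_smul_left hf hZ]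
    simp [dir]
    rw [hs x (Y x) (Z x)]; ring
  add {Z W} hZ hW := by
    simp [dTwo, dir_add (hb.mdiff hY hZ) (hb.mdiff hY hW), dir_add (hb.mdiff hZ hX) (hb.mdiff hW hX), mlieBracket_add_right hZ hW, mlieBracket_add_left hZ hW]
    simp [dir]; ring

/-- A section `X + ξ` of the generalized tangent bundle `TM ⊕ T*M`. -/
abbrev GenSection (E M : Type*) [NormedAddCommGroup E] [NormedSpace ℝ E]
  [TopologicalSpace M] [ChartedSpace E M] : Type _ := VField E M × OneForm E M

/-- The Dorfman bracket `[X + ξ, Y + η]_D = [X, Y] + L_X η - ι_Y dξ`. -/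
noncomputable def dorfman (u v : GenSection E M) : GenSection E M :=
  (mlieBracket 𝓘(ℝ, E) u.1 v.1, lieD u.1 v.2 - iotaD v.1 u.2)

/-- The Courant bracket, the skew-symmetrization of the Dorfman bracket. -/
noncomputable def courant (u v : GenSection E M) : GenSection E M :=
  (1 / 2 : ℝ) • (dorfman u v - dorfman v u)

/-- The covariant derivative `(∇_X b)(Y, Z)` of a bilinear form with respect to `∇`. -/
noncomputable def covBilin (nab : VField E M → VField E M → VField E M) (b : BilinField E M)
    (X Y Z : VField E M) : M → ℝ := fun x =>
  dir X (fun y => b y (Y y) (Z y)) x - b x (nab X Y x) (Z x) - b x (Y x) (nab X Z x)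

/-- The covariant derivative `(∇_X A) Y = ∇_X (A Y) - A (∇_X Y)` of an endomorphism. -/
noncomputable def covEnd (nab : VField E M → VField E M → VField E M) (A : EndField E M)
    (X Y : VField E M) : VField E M := nab X (A.app Y) - A.app (nab X Y)

end Calculus

section Metric

variable {E : Type*} [NormedAddCommGroup E] [NormedSpace ℝ E] [FiniteDimensional ℝ E]
  {M : Type*} [TopologicalSpace M] [ChartedSpace E M] [IsManifold 𝓘(ℝ, E) ∞ M]

variable (E M) in
/-- Smooth Riemannian metrics on `M`. -/
abbrev RMetric : Type _ :=
  ContMDiffRiemannianMetric 𝓘(ℝ, E) ∞ E (TangentSpace 𝓘(ℝ, E) : M → Type _)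

theorem RMetric.inner_bijective (g : RMetric E M) (x : M) : Function.Bijective (g.inner x) := by
  have hinj : Function.Injective (g.inner x) := by
    intro v w h
    by_contra hne
    have h1 := g.pos x (v - w) (sub_ne_zero.mpr hne)
    have h2 : g.inner x (v - w) = 0 := by rw [map_sub, h, sub_self]
    rw [h2] at h1
    simp at h1
  have : FiniteDimensional ℝ (TangentSpace 𝓘(ℝ, E) x) := inferInstanceAs (FiniteDimensional ℝ E)
  have : FiniteDimensional ℝ (TangentSpace 𝓘(ℝ, E) x →L[ℝ] ℝ) :=
    inferInstanceAs (FiniteDimensional ℝ (E →L[ℝ] ℝ))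
  refine ⟨hinj, ?_⟩
  have hdim : Module.finrank ℝ (TangentSpace 𝓘(ℝ, E) x)
      = Module.finrank ℝ (TangentSpace 𝓘(ℝ, E) x →L[ℝ] ℝ) := by
    change Module.finrank ℝ E = Module.finrank ℝ (E →L[ℝ] ℝ)
    rw [← (LinearMap.toContinuousLinearMap (𝕜 := ℝ) (E := E) (F' := ℝ)).finrank_eq]
    exact (Subspace.dual_finrank_eq (K := ℝ) (V := E)).symm
  exact (LinearMap.injective_iff_surjective_of_finrank_eq_finrank
    (f := (g.inner x).toLinearMap) hdim).mp hinj

/-- The musical isomorphism `g⁻¹ : T*M → TM`. -/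
noncomputable def RMetric.sharp (g : RMetric E M) (x : M) :
    (TangentSpace 𝓘(ℝ, E) x →L[ℝ] ℝ) →L[ℝ] TangentSpace 𝓘(ℝ, E) x :=
  haveI : FiniteDimensional ℝ (TangentSpace 𝓘(ℝ, E) x →L[ℝ] ℝ) :=
    inferInstanceAs (FiniteDimensional ℝ (E →L[ℝ] ℝ))
  haveI : T2Space (TangentSpace 𝓘(ℝ, E) x →L[ℝ] ℝ) :=
    inferInstanceAs (T2Space (E →L[ℝ] ℝ))
  haveI : IsTopologicalAddGroup (TangentSpace 𝓘(ℝ, E) x →L[ℝ] ℝ) :=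
    inferInstanceAs (IsTopologicalAddGroup (E →L[ℝ] ℝ))
  LinearMap.toContinuousLinearMap
    ((LinearEquiv.ofBijective (g.inner x).toLinearMap (g.inner_bijective x)).symm.toLinearMap)

theorem RMetric.inner_sharp (g : RMetric E M) (x : M) (κ : TangentSpace 𝓘(ℝ, E) x →L[ℝ] ℝ) :
    g.inner x (g.sharp x κ) = κ :=
  (LinearEquiv.ofBijective (g.inner x).toLinearMap (g.inner_bijective x)).apply_symm_apply κ

/-- The right-hand side of the Koszul formula. -/
noncomputable def RMetric.koszul (g : RMetric E M) (X Y Z : VField E M) : M → ℝ := fun x =>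
  dir X (fun y => g.inner y (Y y) (Z y)) x + dir Y (fun y => g.inner y (X y) (Z y)) x
    - dir Z (fun y => g.inner y (X y) (Y y)) x
    + g.inner x (mlieBracket 𝓘(ℝ, E) X Y x) (Z x)
    - g.inner x (mlieBracket 𝓘(ℝ, E) X Z x) (Y x)
    - g.inner x (mlieBracket 𝓘(ℝ, E) Y Z x) (X x)

/-- The Levi-Civita connection `∇_X Y` of `g`, defined by the Koszul formula. -/
noncomputable def RMetric.leviCivita (g : RMetric E M) (X Y : VField E M) : VField E M :=
  fun x => g.sharp x ((1 / 2 : ℝ) • covectorOf (fun Z => g.koszul X Y Z x) x)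

theorem koszul_tensorial {X Y : VField E M} (g : RMetric E M) {x : M}
   (hX : MDiffAt (T% X) x) (hY : MDiffAt (T% Y) x) :
    TensorialAt 𝓘(ℝ, E) E (fun Z => g.koszul X Y Z x) x where
  smul {f Z} hf hZ := by
    have hb : SmoothBilin g.inner := g.contMDiff
    simp [RMetric.koszul, dir_mul hf (hb.mdiff hY hZ), dir_mul hf (hb.mdiff hX hZ), mlieBracket_smul_right hf hZ]
    simp [dir]
    rw [g.symm x (Z x) (X x), g.symm x (Z x) (Y x)]; ring
  add {Z W} hZ hW := by
    have hb : SmoothBilin g.inner := g.contMDiff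
    simp [RMetric.koszul, dir_add (hb.mdiff hY hZ) (hb.mdiff hY hW), dir_add (hb.mdiff hX hZ) (hb.mdiff hX hW), mlieBracket_add_right hZ hW]
    simp [dir]; ring

theorem RMetric.inner_leviCivita (g : RMetric E M) {X Y Z : VField E M} {x : M}
   (hX : MDiffAt (T% X) x) (hY : MDiffAt (T% Y) x) (hZ : MDiffAt (T% Z) x) :
   g.inner x (g.leviCivita X Y x) (Z x) = 1/2 * g.koszul X Y Z x := by
  simp [RMetric.leviCivita, g.inner_sharp, covectorOf_apply (koszul_tensorial g hX hY) hZ]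

/-- The Levi-Civita connection is compatible with the metric. -/
theorem RMetric.leviCivita_metric (g : RMetric E M) {X Y Z : VField E M} {x : M}
   (hX : MDiffAt (T% X) x) (hY : MDiffAt (T% Y) x) (hZ : MDiffAt (T% Z) x) :
   covBilin g.leviCivita g.inner X Y Z x = 0 := by
  have h1 : ∀ U V : VField E M, (fun y => g.inner y (U y) (V y)) = (fun y => g.inner y (V y) (U y)) := fun U V => funext fun y => g.symm _ _ _
  have h2 := fun U V => mlieBracket_swap_apply (I := 𝓘(ℝ, E)) (V := U) (W := V) (x := x)
  rw [covBilin, g.symm x (Y x), RMetric.inner_leviCivita g hX hY hZ, RMetric.inner_leviCivita g hX hZ hY]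
  simp only [RMetric.koszul]
  rw [h1 Z Y, h1 X Z, h1 X Y, h2 Z Y]
  simp
  ring

/-- The Levi-Civita connection is torsion-free. -/
theorem RMetric.leviCivita_torsion (g : RMetric E M) {X Y : VField E M} {x : M}
   (hX : MDiffAt (T% X) x) (hY : MDiffAt (T% Y) x) :
   g.leviCivita X Y x - g.leviCivita Y X x = mlieBracket 𝓘(ℝ, E) X Y x := by
  apply (g.inner_bijective x).1
  ext v
  obtain ⟨Z, hZ, rfl⟩ : ∃ Z : VField E M, MDiffAt (T% Z) x ∧ Z x = v := ⟨FiberBundle.extend E v, FiberBundle.mdifferentiableAt_extend .., by simp⟩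
  rw [map_sub, sub_apply, RMetric.inner_leviCivita g hX hY hZ, RMetric.inner_leviCivita g hY hX hZ]
  have h1 : ∀ U V : VField E M, (fun y => g.inner y (U y) (V y)) = (fun y => g.inner y (V y) (U y)) := fun U V => funext fun y => g.symm _ _ _
  have h2 := fun U V => mlieBracket_swap_apply (I := 𝓘(ℝ, E)) (V := U) (W := V) (x := x)
  simp only [RMetric.koszul]
  rw [h1 Y X, h2 Y X]
  simp
  ring

/-- The `2`-form `F(X, Y) = g(A X, Y)`. -/
noncomputable def RMetric.fundForm (g : RMetric E M) (A : EndField E M) : BilinField E M :=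
  fun x => (g.inner x).comp (A x)

/-- `(M, g, A)` is a weak almost Hermitian manifold: `dim M = 2n ≥ 4` and `A` is a smooth
`g`-skew-symmetric non-singular endomorphism of `TM`. -/
structure IsWeakAlmostHermitian (g : RMetric E M) (A : EndField E M) : Prop where
  dim : ∃ n : ℕ, 2 ≤ n ∧ Module.finrank ℝ E = 2 * n
  smooth : SmoothEnd A
  skew : ∀ (x : M) (v w : TangentSpace 𝓘(ℝ, E) x), g.inner x (A x v) w = - g.inner x v (A x w)
  nonsingular : ∀ x : M, Function.Bijective (A x)

/-- `(M, g, A, Q)` is a weak nearly Kähler manifold: `(M, g, A)` is weak almost Hermitian,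
`Q = -A²` and `(∇_X A) X = 0` for the Levi-Civita connection `∇`, equivalently
`(∇_X F)(X, Y) = 0` for the fundamental form `F(X, Y) = g(A X, Y)`; both forms are recorded. -/
structure IsWeakNearlyKahler (g : RMetric E M) (A Q : EndField E M) : Prop
    extends IsWeakAlmostHermitian g A where
  Q_eq : ∀ (x : M) (v : TangentSpace 𝓘(ℝ, E) x), Q x v = - A x (A x v)
  covEnd_eq_zero : ∀ X : VField E M, SmoothVF X → covEnd g.leviCivita A X X = 0
  covFundForm_eq_zero : ∀ X Y : VField E M, SmoothVF X → SmoothVF Y →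
    covBilin g.leviCivita (g.fundForm A) X X Y = 0

variable (E M) in
/-- A generalized metric on `TM ⊕ T*M`, given by a Riemannian metric `g` and a `2`-form `b`. Its
positive definite subbundle is `V⁺ = {X + g X + b X}`, where `g X = g(X, ·)` and `b X = b(X, ·)`;
the orthogonal complement is `V⁻ = {X - g X + b X}`. -/
structure GeneralizedMetric where
  g : RMetric E M
  b : BilinField E M
  b_alt : ∀ (x : M) (v : TangentSpace 𝓘(ℝ, E) x), b x v v = 0
  b_smooth : SmoothBilin b

namespace GeneralizedMetric

variable (G : GeneralizedMetric E M)

/-- `X⁺ = X + g X + b X`, a section of `V⁺`. -/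
noncomputable def plus (X : VField E M) : GenSection E M := (X, fun x => G.g.inner x (X x) + G.b x (X x))

/-- `X⁻ = X - g X + b X`, a section of `V⁻`. -/
noncomputable def minus (X : VField E M) : GenSection E M := (X, fun x => - G.g.inner x (X x) + G.b x (X x))

/-- The endomorphism `G` of `TM ⊕ T*M`, with blocks `-g⁻¹b`, `g⁻¹`, `g - b g⁻¹ b`, `b g⁻¹`. -/
noncomputable def endo (u : GenSection E M) : GenSection E M :=
  (fun x => - G.g.sharp x (G.b x (u.1 x)) + G.g.sharp x (u.2 x),
   fun x => G.g.inner x (u.1 x) - G.b x (G.g.sharp x (G.b x (u.1 x))) + G.b x (G.g.sharp x (u.2 x)))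

/-- The projection `u ↦ u₊ = (u + G u) / 2` onto `V⁺` along `V⁻`. -/
noncomputable def projPlus (u : GenSection E M) : GenSection E M := (1 / 2 : ℝ) • (u + G.endo u)

theorem projPlus_plus (X : VField E M) : G.projPlus (G.plus X) = G.plus X := by
  have h1 : ∀ x v, G.g.sharp x (G.g.inner x v) = v := fun x v =>
    (G.g.inner_bijective x).1 (G.g.inner_sharp x _)
  have h : G.endo (G.plus X) = G.plus X := by
    refine Prod.ext (funext fun x => ?_) (funext fun x => ?_)
    · simp [endo, plus, h1]
    · simp [endo, plus, h1, map_add]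
  rw [projPlus, h, ← two_smul ℝ, smul_smul]
  norm_num

theorem projPlus_minus (X : VField E M) : G.projPlus (G.minus X) = 0 := by
  have h1 : ∀ x v, G.g.sharp x (G.g.inner x v) = v := fun x v =>
    (G.g.inner_bijective x).1 (G.g.inner_sharp x _)
  have h : G.endo (G.minus X) = - G.minus X := by
    refine Prod.ext (funext fun x => ?_) (funext fun x => ?_)
    · simp [endo, minus, h1]
    · simp [endo, minus, h1, map_add, add_comm]
  rw [projPlus, h, add_neg_cancel, smul_zero]

/-- The affine connection `∇⁺_X Y = π(([X⁻, Y⁺]_C)₊)` induced by the generalized metric, where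
`π : TM ⊕ T*M → TM` is the projection. -/
noncomputable def nablaPlus (X Y : VField E M) : VField E M :=
  (G.projPlus (courant (G.minus X) (G.plus Y))).1

/-- The endomorphism `A = g⁻¹ b`, i.e. `g(A X, Y) = b(X, Y)`. -/
noncomputable def A : EndField E M := fun x => (G.g.sharp x).comp (G.b x)

theorem inner_A (x : M) (v w : TangentSpace 𝓘(ℝ, E) x) : G.g.inner x (G.A x v) w = G.b x v w := by
  simp [A, G.g.inner_sharp]

/-- `Q = -A²`. -/
noncomputable def Q : EndField E M := fun x => - (G.A x).comp (G.A x)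

/-- The vector field `g⁻¹(db(X, Y))`. -/
noncomputable def sharpD (X Y : VField E M) : VField E M :=
  fun x => G.g.sharp x (dTwoForm G.b X Y x)

/-- `b` is non-degenerate at each point. -/
def NonDegenerate : Prop :=
  ∀ (x : M) (v : TangentSpace 𝓘(ℝ, E) x), (∀ w : TangentSpace 𝓘(ℝ, E) x, G.b x v w = 0) → v = 0

/-- `∇⁺ b = 0`. -/
def NablaPlusBZero : Prop :=
  ∀ X Y Z : VField E M, SmoothVF X → SmoothVF Y → SmoothVF Z →
    covBilin G.nablaPlus G.b X Y Z = 0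

end GeneralizedMetric

end Metric

end GenGeom

open GenGeom

/-! Write T = db and ∇ for the Levi-Civita connection. The Courant bracket gives ∇⁺ = ∇ + ½ g⁻¹T
(`nablaPlus_eq`), so ∇⁺b = 0 expresses ∇b algebraically through T and A (`covBilin_leviCivita`).
Since ∇ is torsion-free, T is the cyclic sum of ∇b; substituting makes every term occur twice, and T
= -(T(A·,·,·) + T(·,A·,·) + T(·,·,A·)) (`dTwo_eq_neg_derivation`).

Apply this relation to (AX, Y, Z) and to (X, AY, Z) and subtract. The right-hand side is exactly
what the compatibility condition makes vanish, so T(AX, Y, Z) = T(X, AY, Z)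
(`SharpDIdentity.dTwo_app_left`). For Y = X the two sides are also opposite by antisymmetry, hence
T(AX, X, Z) = 0. That quantity is 2(∇_X b)(X, Z), and b is the fundamental form of A, so the nearly
Kähler condition follows. Non-degeneracy of b enters only in the bijectivity of A. -/

namespace GenGeom

/-! ### Smooth vector fields and their global extension -/

section Sections

variable {E : Type*} [NormedAddCommGroup E] [NormedSpace ℝ E]
  {M : Type*} [TopologicalSpace M] [ChartedSpace E M] [IsManifold 𝓘(ℝ, E) ∞ M]

omit [IsManifold 𝓘(ℝ, E) ∞ M] in
theorem dir_neg (X : VField E M) (f : M → ℝ) (x : M) :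
    dir X (fun y => -f y) x = -dir X f x := by
  have : mvfderiv 𝓘(ℝ, E) (-f) x = _ := mvfderiv_neg ..
  change mvfderiv 𝓘(ℝ, E) (-f) x (X x) = _
  rw [this]
  rfl

theorem SmoothVF.mdiff {X : VField E M} (hX : SmoothVF X) (x : M) : MDiffAt (T% X) x :=
  (hX x).mdifferentiableAt (by simp)

/-- The value of a smooth endomorphism field at a smooth vector field is smooth. -/
theorem SmoothEnd.app {A : EndField E M} (hA : SmoothEnd A) {X : VField E M} (hX : SmoothVF X) :
    SmoothVF (A.app X) := fun x => (hA x).clm_bundle_apply (hX x)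

theorem SmoothEnd.mdiff_app {A : EndField E M} (hA : SmoothEnd A) {X : VField E M} {x : M}
    (hX : MDiffAt (T% X) x) : MDiffAt (T% (A.app X)) x :=
  ((hA x).mdifferentiableAt (by simp)).clm_bundle_apply hX

/-- Every tangent vector extends to a global smooth vector field. -/
theorem exists_smoothVF_eq [FiniteDimensional ℝ E] [T2Space M] (x : M)
    (v : TangentSpace 𝓘(ℝ, E) x) : ∃ X : VField E M, SmoothVF X ∧ X x = v := by
  obtain ⟨s, hs, hsm⟩ := FiberBundle.exists_contMDiffOn_extend (k := ∞) 𝓘(ℝ, E) E v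
  obtain ⟨t, hts, ht, hxt⟩ := mem_nhds_iff.mp hs
  -- Only the index condition of the basis, `tsupport f ⊆ t`, matters here; the neighbourhood it is
  -- applied to is the whole of `M`.
  obtain ⟨f, hf, -⟩ := (SmoothBumpFunction.nhds_basis_support (I := 𝓘(ℝ, E))
    (ht.mem_nhds hxt)).mem_iff.mp Filter.univ_mem
  refine ⟨fun y => f y • FiberBundle.extend E v y, ?_, by simp⟩
  have h := ContMDiffOn.smul_section_of_tsupport (s := FiberBundle.extend E v)
    (f.contMDiff.contMDiffOn (s := t)) ht hf (hsm.mono hts)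
  exact h

end Sections

/-! ### Raising an index with the metric -/

section Metric

variable {E : Type*} [NormedAddCommGroup E] [NormedSpace ℝ E] [FiniteDimensional ℝ E]
  {M : Type*} [TopologicalSpace M] [ChartedSpace E M] [IsManifold 𝓘(ℝ, E) ∞ M]

omit [FiniteDimensional ℝ E] in
theorem RMetric.smoothBilin (g : RMetric E M) : SmoothBilin g.inner := g.contMDiff

theorem RMetric.sharp_inner (g : RMetric E M) (x : M) (v : TangentSpace 𝓘(ℝ, E) x) :
    g.sharp x (g.inner x v) = v :=
  (g.inner_bijective x).1 (g.inner_sharp x _)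

/-- The metric as a continuous linear isomorphism from tangent vectors to covectors. -/
noncomputable def RMetric.flatEquiv (g : RMetric E M) (x : M) :
    TangentSpace 𝓘(ℝ, E) x ≃L[ℝ] (TangentSpace 𝓘(ℝ, E) x →L[ℝ] ℝ) :=
  ContinuousLinearEquiv.equivOfInverse (g.inner x) (g.sharp x) (g.sharp_inner x) (g.inner_sharp x)

/-- Raising an index of a smooth bilinear form with a smooth metric gives a smooth
endomorphism field. -/
theorem RMetric.smoothEnd_sharp_comp (g : RMetric E M) {b : BilinField E M} (hb : SmoothBilin b) :
    SmoothEnd (fun x => (g.sharp x).comp (b x)) := by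
  intro x₀
  have hg := ((contMDiffAt_hom_bundle _).mp (g.smoothBilin x₀)).2
  have hb' := ((contMDiffAt_hom_bundle _).mp (hb x₀)).2
  refine (contMDiffAt_hom_bundle _).mpr ⟨contMDiffAt_id, ?_⟩
  -- Over the base sets of the trivializations the coordinate expression of g is an isomorphism e,
  -- and that of g⁻¹b is e⁻¹ composed with the coordinate expression of b. Smoothness then reduces
  -- to smoothness of operator inversion at an invertible operator.
  have key : ∀ᶠ x in 𝓝 x₀, ∃ e : E ≃L[ℝ] (E →L[ℝ] ℝ),
      ContinuousLinearMap.inCoordinates E (TangentSpace 𝓘(ℝ, E) : M → Type _) (E →L[ℝ] ℝ)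
        (fun x : M => TangentSpace 𝓘(ℝ, E) x →L[ℝ] ℝ) x₀ x x₀ x (g.inner x) = e ∧
      ContinuousLinearMap.inCoordinates E (TangentSpace 𝓘(ℝ, E) : M → Type _) E
        (TangentSpace 𝓘(ℝ, E) : M → Type _) x₀ x x₀ x ((g.sharp x).comp (b x)) =
      (e.symm : (E →L[ℝ] ℝ) →L[ℝ] E).comp
        (ContinuousLinearMap.inCoordinates E (TangentSpace 𝓘(ℝ, E) : M → Type _) (E →L[ℝ] ℝ)
          (fun x : M => TangentSpace 𝓘(ℝ, E) x →L[ℝ] ℝ) x₀ x x₀ x (b x)) := by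
    filter_upwards [(trivializationAt E (TangentSpace 𝓘(ℝ, E) : M → Type _) x₀).open_baseSet.mem_nhds
        (FiberBundle.mem_baseSet_trivializationAt' x₀),
      (trivializationAt (E →L[ℝ] ℝ) (fun x : M => TangentSpace 𝓘(ℝ, E) x →L[ℝ] ℝ)
        x₀).open_baseSet.mem_nhds (FiberBundle.mem_baseSet_trivializationAt' x₀)] with x h₁ h₂
    refine ⟨(((trivializationAt E (TangentSpace 𝓘(ℝ, E) : M → Type _)
      x₀).continuousLinearEquivAt ℝ x h₁).symm.trans (g.flatEquiv x)).trans
      ((trivializationAt (E →L[ℝ] ℝ) (fun x : M => TangentSpace 𝓘(ℝ, E) x →L[ℝ] ℝ)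
        x₀).continuousLinearEquivAt ℝ x h₂), ?_, ?_⟩
    · rw [ContinuousLinearMap.inCoordinates_eq h₁ h₂]
      rfl
    · rw [ContinuousLinearMap.inCoordinates_eq h₁ h₁, ContinuousLinearMap.inCoordinates_eq h₁ h₂]
      ext v
      simp only [ContinuousLinearMap.comp_apply, ContinuousLinearEquiv.coe_coe,
        ContinuousLinearEquiv.symm_trans_apply, ContinuousLinearEquiv.symm_apply_apply,
        ContinuousLinearEquiv.symm_symm]
      rfl
  have hinv := ContDiffAt.comp_contMDiffAt
    (ContinuousLinearMap.IsInvertible.contDiffAt_map_inverse (n := ∞)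
      (by obtain ⟨e, he, -⟩ := key.self_of_nhds; exact ⟨e, he.symm⟩)) hg
  refine (hinv.clm_comp hb').congr_of_eventuallyEq ?_
  filter_upwards [key] with x ⟨e, he, h⟩
  simp only [Function.comp_apply]
  erw [he, h, ContinuousLinearMap.inverse_equiv]

/-! ### Symmetries of b and db -/

namespace GeneralizedMetric

variable (G : GeneralizedMetric E M)

omit [FiniteDimensional ℝ E] in
theorem b_swap (x : M) (v w : TangentSpace 𝓘(ℝ, E) x) : G.b x v w = -G.b x w v := by
  have h := G.b_alt x (v + w)
  simp only [map_add, add_apply, G.b_alt] at h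
  linarith

theorem b_eq_neg_inner_A (x : M) (v w : TangentSpace 𝓘(ℝ, E) x) :
    G.b x v w = -G.g.inner x v (G.A x w) := by
  rw [b_swap, ← G.inner_A, G.g.symm]

theorem smoothEnd_A : SmoothEnd G.A := G.g.smoothEnd_sharp_comp G.b_smooth

omit [FiniteDimensional ℝ E] in
theorem dir_b_swap (X Y Z : VField E M) (x : M) :
    dir X (fun y => G.b y (Y y) (Z y)) x = -dir X (fun y => G.b y (Z y) (Y y)) x := by
  rw [← dir_neg]
  exact congrArg (fun f => dir X f x) (funext fun y => G.b_swap y _ _)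

/-- `b(g⁻¹(db(X, Y)), Z) = -db(X, Y, AZ)`. -/
theorem b_sharpD {X Y Z : VField E M} {x : M} (hX : MDiffAt (T% X) x) (hY : MDiffAt (T% Y) x)
    (hZ : MDiffAt (T% Z) x) :
    G.b x (G.sharpD X Y x) (Z x) = -dTwo G.b X Y (G.A.app Z) x := by
  rw [G.b_eq_neg_inner_A, sharpD, G.g.inner_sharp, dTwoForm]
  exact congrArg _ (covectorOf_apply (dTwo_tensorial G.b_smooth G.b_swap hX hY)
    (G.smoothEnd_A.mdiff_app hZ))

theorem inner_sharpD {X Y Z : VField E M} {x : M} (hX : MDiffAt (T% X) x) (hY : MDiffAt (T% Y) x)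
    (hZ : MDiffAt (T% Z) x) :
    G.g.inner x (G.sharpD X Y x) (Z x) = dTwo G.b X Y Z x := by
  rw [sharpD, G.g.inner_sharp, dTwoForm,
    covectorOf_apply (dTwo_tensorial G.b_smooth G.b_swap hX hY) hZ]

theorem dTwo_swap (X Y Z : VField E M) (x : M) : dTwo G.b X Y Z x = -dTwo G.b Y X Z x := by
  have hm := fun U V => mlieBracket_swap_apply (I := 𝓘(ℝ, E)) (V := U) (W := V) (x := x)
  simp only [dTwo]
  rw [G.dir_b_swap X Y Z, G.dir_b_swap Y Z X, G.dir_b_swap Z X Y, hm X Y, hm Y Z, hm Z X]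
  simp
  ring

omit [FiniteDimensional ℝ E] [IsManifold 𝓘(ℝ, E) ∞ M] in
theorem dTwo_cycle (b : BilinField E M) (X Y Z : VField E M) (x : M) :
    dTwo b X Y Z x = dTwo b Y Z X x := by
  simp only [dTwo]; ring

/-! ### The connection ∇⁺ and its parallel 2-form -/

/-- `∇⁺_X Y = ∇_X Y + ½ g⁻¹(db(X, Y))`, with `∇` the Levi-Civita connection. -/
theorem nablaPlus_eq {X Y : VField E M} {x : M} (hX : SmoothVF X) (hY : SmoothVF Y) :
    G.nablaPlus X Y x = G.g.leviCivita X Y x + (1 / 2 : ℝ) • G.sharpD X Y x := by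
  apply (G.g.inner_bijective x).1
  ext v
  obtain ⟨Z, hZ, rfl⟩ : ∃ Z : VField E M, MDiffAt (T% Z) x ∧ Z x = v :=
    ⟨FiberBundle.extend E v, FiberBundle.mdifferentiableAt_extend .., by simp⟩
  have hX := hX.mdiff x
  have hY := hY.mdiff x
  have hgd := fun {U V : VField E M} (hU : MDiffAt (T% U) x) (hV : MDiffAt (T% V) x) =>
    G.g.smoothBilin.mdiff hU hV
  have hbd := fun {U V : VField E M} (hU : MDiffAt (T% U) x) (hV : MDiffAt (T% V) x) =>
    G.b_smooth.mdiff hU hV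
  have hη : OneForm.DiffAt (G.plus Y).2 x := fun W hW => (hgd hY hW).add (hbd hY hW)
  have hξ : OneForm.DiffAt (G.minus X).2 x := fun W hW => (hgd hX hW).neg.add (hbd hX hW)
  have hp : ∀ W U V : VField E M, MDiffAt (T% U) x → MDiffAt (T% V) x →
      dir W (fun y => (G.plus U).2 y (V y)) x
        = dir W (fun y => G.g.inner y (U y) (V y)) x + dir W (fun y => G.b y (U y) (V y)) x :=
    fun W U V hU hV => dir_add (hgd hU hV) (hbd hU hV)
  have hm : ∀ W U V : VField E M, MDiffAt (T% U) x → MDiffAt (T% V) x →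
      dir W (fun y => (G.minus U).2 y (V y)) x
        = -dir W (fun y => G.g.inner y (U y) (V y)) x + dir W (fun y => G.b y (U y) (V y)) x :=
    fun W U V hU hV => by
      refine (dir_add (hgd hU hV).neg (hbd hU hV)).trans ?_
      simp [dir]
  have hgs : ∀ U V : VField E M,
      (fun y => G.g.inner y (U y) (V y)) = (fun y => G.g.inner y (V y) (U y)) :=
    fun U V => funext fun y => G.g.symm _ _ _
  have hl := fun U V => mlieBracket_swap_apply (I := 𝓘(ℝ, E)) (V := U) (W := V) (x := x)
  rw [map_add, map_smul, add_apply, smul_apply, G.g.inner_leviCivita hX hY hZ,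
    G.inner_sharpD hX hY hZ]
  -- The tangent part of the projection of U + ξ onto V⁺ is ½(U + g⁻¹(ξ - bU)).
  have e : G.nablaPlus X Y x = (1 / 2 : ℝ) • ((courant (G.minus X) (G.plus Y)).1 x
      + (-G.g.sharp x (G.b x ((courant (G.minus X) (G.plus Y)).1 x))
        + G.g.sharp x ((courant (G.minus X) (G.plus Y)).2 x))) := rfl
  have e₁ : (courant (G.minus X) (G.plus Y)).1 x = mlieBracket 𝓘(ℝ, E) X Y x := by
    change (1 / 2 : ℝ) • (mlieBracket 𝓘(ℝ, E) X Y x - mlieBracket 𝓘(ℝ, E) Y X x) = _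
    rw [hl Y X, sub_neg_eq_add, ← two_smul ℝ, smul_smul]
    norm_num
  have e₂ : (courant (G.minus X) (G.plus Y)).2 x (Z x) = 1 / 2 *
      ((dir X (fun y => (G.plus Y).2 y (Z y)) x - (G.plus Y).2 x (mlieBracket 𝓘(ℝ, E) X Z x)
          - dOne (G.minus X).2 Y Z x)
        - (dir Y (fun y => (G.minus X).2 y (Z y)) x
            - (G.minus X).2 x (mlieBracket 𝓘(ℝ, E) Y Z x) - dOne (G.plus Y).2 X Z x)) := by
    -- The four functionals are tensorial because both 1-forms are differentiable at x, so their
    -- values at Z are those of the forms `lieD` and `iotaD` in the bracket.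
    rw [← covectorOf_apply (lieD_tensorial (X := X) hη) hZ,
      ← covectorOf_apply (lieD_tensorial (X := Y) hξ) hZ,
      ← covectorOf_apply (dOne_tensorial (Y := X) hη) hZ,
      ← covectorOf_apply (dOne_tensorial (Y := Y) hξ) hZ]
    rfl
  -- After pairing with Z, the terms in g assemble into the Koszul expression and the terms in b
  -- into db(X, Y, Z).
  rw [e, e₁, map_smul, map_add, map_add, map_neg, G.g.inner_sharp, G.g.inner_sharp]
  simp only [smul_apply, add_apply, neg_apply, e₂, dOne, hp _ _ _ hY hZ, hp _ _ _ hY hX,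
    hm _ _ _ hX hZ, hm _ _ _ hX hY, RMetric.koszul, dTwo]
  rw [hgs Y X, G.dir_b_swap Z Y X, G.dir_b_swap Y Z X, hl Z X]
  simp only [plus, minus, add_apply, neg_apply, map_neg, smul_eq_mul]
  rw [G.g.symm x (mlieBracket 𝓘(ℝ, E) X Z x), G.g.symm x (mlieBracket 𝓘(ℝ, E) Y Z x),
    G.b_swap x (mlieBracket 𝓘(ℝ, E) X Z x), G.b_swap x (mlieBracket 𝓘(ℝ, E) Y Z x)]
  ring

/-- If `∇⁺b = 0` then `2(∇_X b)(Y, Z) = db(X, Z, AY) - db(X, Y, AZ)`. -/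
theorem covBilin_leviCivita (hpar : G.NablaPlusBZero) {X Y Z : VField E M} (hX : SmoothVF X)
    (hY : SmoothVF Y) (hZ : SmoothVF Z) (x : M) :
    covBilin G.g.leviCivita G.b X Y Z x
      = 1 / 2 * (dTwo G.b X Z (G.A.app Y) x - dTwo G.b X Y (G.A.app Z) x) := by
  have h := congrFun (hpar X Y Z hX hY hZ) x
  simp only [covBilin, Pi.zero_apply] at h ⊢
  rw [G.nablaPlus_eq hX hY, G.nablaPlus_eq hX hZ] at h
  simp only [map_add, map_smul, add_apply, smul_apply, smul_eq_mul] at h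
  rw [G.b_sharpD (hX.mdiff x) (hY.mdiff x) (hZ.mdiff x), G.b_swap x (Y x) (G.sharpD X Z x),
    G.b_sharpD (hX.mdiff x) (hZ.mdiff x) (hY.mdiff x)] at h
  linarith

/-- The exterior derivative of `b` is the cyclic sum of its Levi-Civita derivative. -/
theorem dTwo_eq_cyclic_covBilin {X Y Z : VField E M} {x : M} (hX : MDiffAt (T% X) x)
    (hY : MDiffAt (T% Y) x) (hZ : MDiffAt (T% Z) x) :
    dTwo G.b X Y Z x = covBilin G.g.leviCivita G.b X Y Z x
      + covBilin G.g.leviCivita G.b Y Z X x + covBilin G.g.leviCivita G.b Z X Y x := by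
  simp only [dTwo, covBilin]
  -- Torsion-freeness turns each bracket in db into a difference of two covariant derivatives; the
  -- six resulting terms are the connection terms of the cyclic sum.
  rw [← G.g.leviCivita_torsion hX hY, ← G.g.leviCivita_torsion hY hZ,
    ← G.g.leviCivita_torsion hZ hX, G.b_swap x (Y x), G.b_swap x (Z x), G.b_swap x (X x)]
  simp only [map_sub, sub_apply]
  ring

/-- If `∇⁺b = 0` then `db(X, Y, Z) = -db(AX, Y, Z) - db(X, AY, Z) - db(X, Y, AZ)`. -/
theorem dTwo_eq_neg_derivation (hpar : G.NablaPlusBZero) {X Y Z : VField E M} (hX : SmoothVF X)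
    (hY : SmoothVF Y) (hZ : SmoothVF Z) (x : M) :
    dTwo G.b X Y Z x = -dTwo G.b (G.A.app X) Y Z x - dTwo G.b X (G.A.app Y) Z x
      - dTwo G.b X Y (G.A.app Z) x := by
  have h := G.dTwo_eq_cyclic_covBilin (hX.mdiff x) (hY.mdiff x) (hZ.mdiff x)
  -- The six terms coincide in pairs up to the symmetries of db, which absorbs the factor ½.
  rw [G.covBilin_leviCivita hpar hX hY hZ, G.covBilin_leviCivita hpar hY hZ hX,
    G.covBilin_leviCivita hpar hZ hX hY, G.dTwo_swap X Z, dTwo_cycle _ Z X,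
    ← dTwo_cycle _ (G.A.app X) Y Z, G.dTwo_swap Y X, G.dTwo_swap Z Y] at h
  linarith [dTwo_cycle G.b (G.A.app X) Y Z x]

/-! ### From the compatibility condition to nearly Kähler -/

/-- The compatibility condition between `b` and `db` in the theorem below. -/
def SharpDIdentity : Prop :=
  ∀ X Y Z : VField E M, SmoothVF X → SmoothVF Y → SmoothVF Z → ∀ x : M,
      G.b x (G.sharpD X (G.A.app Y) x - G.sharpD (G.A.app X) Y x) (Z x)
        + G.b x (G.sharpD (G.A.app Y) Z x) (X x)
        - G.b x (G.sharpD Y Z x) (G.A x (X x))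
        - G.b x (G.sharpD Z (G.A.app X) x) (Y x)
        + G.b x (G.sharpD Z X x) (G.A x (Y x)) = 0

variable {G}

/-- With T = db, the two terms T(AX, AY, Z) in the compatibility condition cancel, leaving T(A²X, Y,
Z) - T(X, A²Y, Z) + T(AX, Y, AZ) - T(X, AY, AZ) = 0. Up to sign this is the difference of the
derivation relations at (AX, Y, Z) and (X, AY, Z). -/
theorem SharpDIdentity.dTwo_app_left (hid : G.SharpDIdentity) (hpar : G.NablaPlusBZero)
    {X Y Z : VField E M} (hX : SmoothVF X) (hY : SmoothVF Y) (hZ : SmoothVF Z) (x : M) :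
    dTwo G.b (G.A.app X) Y Z x = dTwo G.b X (G.A.app Y) Z x := by
  have hAX := G.smoothEnd_A.app hX
  have hAY := G.smoothEnd_A.app hY
  have h := hid X Y Z hX hY hZ x
  have e₁ := G.b_sharpD (hY.mdiff x) (hZ.mdiff x) (hAX.mdiff x)
  have e₂ := G.b_sharpD (hZ.mdiff x) (hX.mdiff x) (hAY.mdiff x)
  simp only [EndField.app] at e₁ e₂
  rw [map_sub, sub_apply, G.b_sharpD (hX.mdiff x) (hAY.mdiff x) (hZ.mdiff x),
    G.b_sharpD (hAX.mdiff x) (hY.mdiff x) (hZ.mdiff x),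
    G.b_sharpD (hAY.mdiff x) (hZ.mdiff x) (hX.mdiff x), e₁,
    G.b_sharpD (hZ.mdiff x) (hAX.mdiff x) (hY.mdiff x), e₂] at h
  have d₁ := G.dTwo_eq_neg_derivation hpar hAX hY hZ x
  have d₂ := G.dTwo_eq_neg_derivation hpar hX hAY hZ x
  have c₁ := dTwo_cycle G.b (G.A.app X) (G.A.app Y) Z x
  have c₂ := dTwo_cycle G.b Z (G.A.app X) (G.A.app Y) x
  have c₃ := dTwo_cycle G.b (G.A.app (G.A.app X)) Y Z x
  have c₄ := dTwo_cycle G.b Z X (G.A.app (G.A.app Y)) x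
  linarith

/-- Under the hypotheses, `(∇_X b)(X, Z) = 0` for the Levi-Civita connection. -/
theorem SharpDIdentity.covBilin_self (hid : G.SharpDIdentity) (hpar : G.NablaPlusBZero)
    {X Z : VField E M} (hX : SmoothVF X) (hZ : SmoothVF Z) (x : M) :
    covBilin G.g.leviCivita G.b X X Z x = 0 := by
  rw [G.covBilin_leviCivita hpar hX hX hZ]
  have h := hid.dTwo_app_left hpar hX hX hZ x
  -- Here db(X, X, AZ) = 0, and db(X, Z, AX) = db(AX, X, Z) equals its own negative.
  linarith [G.dTwo_swap X X (G.A.app Z) x, G.dTwo_swap X (G.A.app X) Z x,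
    dTwo_cycle G.b (G.A.app X) X Z x]

/-- Metric compatibility gives g((∇_X A)X, Z) = (∇_X b)(X, Z). The test field Z must be globally
smooth, because ∇⁺b = 0 and the compatibility condition are only assumed for such fields. -/
theorem SharpDIdentity.covEnd_self [T2Space M] (hid : G.SharpDIdentity) (hpar : G.NablaPlusBZero)
    {X : VField E M} (hX : SmoothVF X) : covEnd G.g.leviCivita G.A X X = 0 := by
  funext x
  apply (G.g.inner_bijective x).1
  ext v
  obtain ⟨Z, hZ, rfl⟩ := exists_smoothVF_eq x v
  have h := hid.covBilin_self hpar hX hZ x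
  have hm := G.g.leviCivita_metric (hX.mdiff x) ((G.smoothEnd_A.app hX).mdiff x) (hZ.mdiff x)
  simp only [covBilin, EndField.app, G.inner_A] at h hm
  simp only [covEnd, Pi.sub_apply, EndField.app, map_sub, sub_apply, G.inner_A, Pi.zero_apply,
    map_zero, zero_apply]
  linarith

theorem NonDegenerate.bijective_A (hb : G.NonDegenerate) (x : M) : Function.Bijective (G.A x) := by
  have : FiniteDimensional ℝ (TangentSpace 𝓘(ℝ, E) x) := inferInstanceAs (FiniteDimensional ℝ E)
  have hinj : Function.Injective (G.A x) := by
    refine (injective_iff_map_eq_zero (G.A x)).mpr fun v hv => hb x v fun w => ?_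
    rw [← G.inner_A, hv, map_zero, zero_apply]
  exact ⟨hinj, (LinearMap.injective_iff_surjective (f := (G.A x).toLinearMap)).mp hinj⟩

theorem fundForm_A : G.g.fundForm G.A = G.b := by
  funext x
  ext v w
  exact G.inner_A x v w

end GeneralizedMetric

end Metric

end GenGeom

open GenGeom
theorem mainTheorem12 {E : Type*} [NormedAddCommGroup E] [NormedSpace ℝ E] [FiniteDimensional ℝ E]
    {M : Type*} [TopologicalSpace M] [ChartedSpace E M] [IsManifold 𝓘(ℝ, E) ∞ M]
    [T2Space M] [SecondCountableTopology M]
    (n : ℕ) (hn : 4 ≤ 2 * n) (hdim : Module.finrank ℝ E = 2 * n)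
    (G : GeneralizedMetric E M)
    (hb : G.NonDegenerate)
    (hpar : G.NablaPlusBZero)
    (hid : ∀ X Y Z : VField E M, SmoothVF X → SmoothVF Y → SmoothVF Z → ∀ x : M,
      G.b x (G.sharpD X (G.A.app Y) x - G.sharpD (G.A.app X) Y x) (Z x)
        + G.b x (G.sharpD (G.A.app Y) Z x) (X x)
        - G.b x (G.sharpD Y Z x) (G.A x (X x))
        - G.b x (G.sharpD Z (G.A.app X) x) (Y x)
        + G.b x (G.sharpD Z X x) (G.A x (Y x)) = 0) :
    IsWeakNearlyKahler G.g G.A G.Q := by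
  have hid : G.SharpDIdentity := hid
  exact {
    dim := ⟨n, by omega, hdim⟩
    smooth := G.smoothEnd_A
    skew := fun x v w => by rw [G.inner_A, G.b_eq_neg_inner_A]
    nonsingular := hb.bijective_A
    Q_eq := fun x v => rfl
    covEnd_eq_zero := fun X hX => hid.covEnd_self hpar hX
    covFundForm_eq_zero := fun X Y hX hY => by
      rw [G.fundForm_A]
      exact funext (hid.covBilin_self hpar hX hY) }
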